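/- Let $A$ be a countable set, $\mathcal X=A^{\mathbb Z}$ and $\mathcal X_-=A^{\{0,-1,-2,\dots\}}$, both with the product $\sigma$-algebra, and let $\eta_n$ be the coordinate maps on $\mathcal X$. Sequences in $\mathcal X_-$ are written from the present into the past: for $a\in A$, $z\in\mathcal X$ and $x\in\mathcal X_-$, the sequence $ax$ has $a$ at time $0$ followed (backwards in time) by $x$, and $z_{-k}^{-1}x$ is the word $(z_{-1},\dots,z_{-k})$ followed by $x$. A *potential* is a measurable $\phi:\mathcal X_-\to\mathbb R$ with $\sum_{a\in A}e^{\phi(ax)}=1$ for all $x\in\mathcal X_-$. For $k\ge1$ put $$\mathrm{var}_k(\phi)=\sup_{z\in\mathcal X}\sup_{x,y\in\mathcal X_-}\sum_{b\in A}\bigl|\phi(bz_{-k}^{-1}x)-\phi(bz_{-k}^{-1}y)\bigr|,\qquad \chi^2_k(\phi)=\sup_{z\in\mathcal X}\sup_{x,y\in\mathcal X_-}\sum_{b\in A}\frac{\bigl(e^{\phi(bz_{-k}^{-1}x)}-e^{\phi(bz_{-k}^{-1}y)}\bigr)^2}{e^{\phi(bz_{-k}^{-1}y)}}.$$ The potential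 $\phi$ is *regular* if $\mathrm{var}_k(\phi)\to0$ as $k\to\infty$ and there is $\varepsilon>0$ with $e^{\phi(x)}\ge\varepsilon$ for all $x\in\mathcal X_-$ (in particular $A$ is then finite). It satisfies *Assumption (A)* with constants $C,\delta>0$ if $\chi^2_k(\phi)\le C/k^{1+\delta}$ for all $k\ge1$. A probability measure $\mu$ on $\mathcal X$ is *compatible* with $\phi$ if its image under $\eta_{-\infty}^0:=(\eta_0,\eta_{-1},\dots)$ is some probability measure on $\mathcal X_-$ and, for every $n\ge1$ and $a\in A$, $\mu[\eta_{n+1}=a\mid\eta_{-\infty}^n=x]=e^{\phi(ax)}$ for almost every $x$, where $\eta_{-\infty}^n:=(\eta_n,\eta_{n-1},\dots)$. **Proposition.** Let $C>0$, $\delta\in(1/2,1]$, $\delta'<2\delta-1$ and $\varepsilon>0$. There is a constant $C_7>0$, depending only on $C,\delta,\delta'$ and $\varepsilon$, such that the following holds for every countable set $A$, every regular potential $\phi$ on $\mathcal X_-$ with $e^{\phi}\ge\varepsilon$ that satisfies Assumption (A) with the constants $C$ and $\delta$, and every probability measure $\mu$ compatible with $\phi$: for all $n\ge1$, $t\ge0$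 and $h:A\to\mathbb R$, $$\mu\left[\left|\frac1n\sum_{i=1}^n\bigl(h(\eta_i)-\mathbb E[h(\eta_i)]\bigr)\right|\ge t\right]\le 2\exp\left(-\frac{C_7\,n^{\delta'}\,t^2}{R(h)^2}\right),$$ where $\mathbb E$ is the expectation under $\mu$ and $R(h)=\max_{a\in A}h(a)-\min_{a\in A}h(a)$. (If $h$ is constant, so that $R(h)=0$, the fraction is read as $0$; the left-hand side is then $0$ for $t>0$.) -/

import Mathlib

open MeasureTheory ProbabilityTheory Filter Topology
open scoped ENNReal

noncomputable section

/-- Bi-infinite sequences over the alphabet `A`, with the product σ-algebra. -/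
abbrev BiSeq (A : Type*) := ℤ → A

/-- One-sided sequences indexed by the non-positive integers. For `x : Past A` and `i : ℕ`, the
letter `x i` is the coordinate of `x` at time `-i`, so increasing `i` goes further into the past. -/
abbrev Past (A : Type*) := ℕ → A

/-- The concatenation `a x`: the letter `a` at time `0`, preceded by the past `x`. -/
def consPast {A : Type*} (a : A) (x : Past A) : Past A
  | 0 => a
  | i + 1 => x i

/-- The concatenation of the word `(z (-1), …, z (-k))` of length `k` with the past `x`. -/
def concatPast {A : Type*} (z : BiSeq A) (k : ℕ) (x : Past A) : Past A :=
  fun i => if i < k then z (-((i : ℤ) + 1)) else x (i - k)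

/-- The sequence `(ω n, ω (n - 1), ω (n - 2), …)`, that is, the past of `ω` up to time `n`. -/
def pastOf {A : Type*} (n : ℤ) (ω : BiSeq A) : Past A := fun i => ω (n - i)

/-- Potentials: measurable functions `φ` with `∑ a, exp (φ (a x)) = 1` for every past `x`. -/
structure IsPotential {A : Type*} [MeasurableSpace A] (φ : Past A → ℝ) : Prop where
  measurable : Measurable φ
  normalized : ∀ x : Past A, HasSum (fun a : A => Real.exp (φ (consPast a x))) 1

/-- The variation rate of order `k`, as an extended nonnegative real. -/
def varRate {A : Type*} (φ : Past A → ℝ) (k : ℕ) : ℝ≥0∞ :=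
  ⨆ (z : BiSeq A) (x : Past A) (y : Past A), ∑' b : A,
    ENNReal.ofReal
      |φ (consPast b (concatPast z k x)) - φ (consPast b (concatPast z k y))|

/-- The `χ²`-variation rate of order `k`, as an extended nonnegative real. -/
def chiSqRate {A : Type*} (φ : Past A → ℝ) (k : ℕ) : ℝ≥0∞ :=
  ⨆ (z : BiSeq A) (x : Past A) (y : Past A), ∑' b : A,
    ENNReal.ofReal
      ((Real.exp (φ (consPast b (concatPast z k x)))
          - Real.exp (φ (consPast b (concatPast z k y)))) ^ 2
        / Real.exp (φ (consPast b (concatPast z k y))))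

/-- Regularity: continuity (the variation rates tend to zero) and positivity of the kernel
`exp φ`, uniformly over all pasts. -/
structure IsRegularPotential {A : Type*} (φ : Past A → ℝ) : Prop where
  continuity : Tendsto (fun k : ℕ => varRate φ k) atTop (𝓝 0)
  positivity : ∃ ε : ℝ, 0 < ε ∧ ∀ x : Past A, ε ≤ Real.exp (φ x)

/-- `φ` is a potential whose `χ²`-variation rate of every order `k ≥ 1` is at most
`C / k ^ (1 + δ)`. -/
structure AssumptionA {A : Type*} [MeasurableSpace A] (φ : Past A → ℝ) (C δ : ℝ) : Prop where
  potential : IsPotential φ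
  C_pos : 0 < C
  δ_pos : 0 < δ
  bound : ∀ k : ℕ, 1 ≤ k → chiSqRate φ k ≤ ENNReal.ofReal (C / (k : ℝ) ^ (1 + δ))

/-- A probability measure `μ` on bi-infinite sequences is compatible with `φ` if its past up to
time `0` has some law `P` and, for `n ≥ 1`, the conditional probability that the coordinate at time
`n + 1` is `a`, given the past `x` up to time `n`, is `exp (φ (a x))`. -/
structure IsCompatible {A : Type*} [MeasurableSpace A] (φ : Past A → ℝ)
    (μ : Measure (BiSeq A)) : Prop where
  isProbabilityMeasure : IsProbabilityMeasure μ
  past_law : ∃ P : Measure (Past A), IsProbabilityMeasure P ∧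
    ∀ B : Set (Past A), MeasurableSet B → μ {ω | pastOf 0 ω ∈ B} = P B
  cond_prob : ∀ n : ℕ, 1 ≤ n → ∀ a : A,
    μ⟦{ω : BiSeq A | ω ((n : ℤ) + 1) = a} |
        MeasurableSpace.comap (pastOf (A := A) (n : ℤ)) inferInstance⟧
      =ᵐ[μ] fun ω => Real.exp (φ (consPast a (pastOf (n : ℤ) ω)))

/-- The range `max h - min h` of a function (used for finite nonempty `A`, where the supremum and
the infimum are attained). -/
def oscRange {A : Type*} (h : A → ℝ) : ℝ := (⨆ a, h a) - ⨅ a, h a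

end

/-
If the expectation of `h (η (i + j))` given the past up to time `i` varies with that past by at most
`d j`, then `∑ h (η i)` has martingale increments of size at most `∑ d j`, and Hoeffding's lemma
gives Gaussian tails. It remains to show that `d 0 + … + d (n - 1)` is of order `n ^ (1 - ρ)` for
every `ρ < δ` in `[0, 1]`, by coupling two chains started from different pasts.

When the chains share their last `k` letters, they are coupled on a whole block of `k ^ (1 - ρ)`
letters at once. The `χ²` divergence tensorizes, so over the block it is of order
`k ^ (1 - ρ) / k ^ (1 + δ)`, and the block fails to be matched with probability of order its square
root `k ^ (-(ρ + δ) / 2)`; coupling letter by letter would lose this square-root gain. As `ρ < δ`,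
these probabilities are summable along successive blocks, so that from some `k₀` common letters on
the total failure probability is at most `1 / 2`. After a failure, `k₀` common letters are produced
again with probability at least `ε ^ k₀` because `exp φ ≥ ε`. Thus there are boundedly many failures
on average, and each one costs at most one block, of length at most `n ^ (1 - ρ)`. For
`ρ = max 0 ((1 + δ') / 2)` the Gaussian rate `n / (n ^ (1 - ρ)) ^ 2` is then at least `n ^ δ'`.
-/

noncomputable section

section FiniteWeights

variable {ι : Type*} [Fintype ι] {p q f f' : ι → ℝ}

/-- The `χ²` divergence of the weights `p` from the weights `q`. It is meant for `q > 0`: a term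
with `q i = 0` contributes `0`. -/
def chiSqDiv (p q : ι → ℝ) : ℝ := ∑ i, (p i - q i) ^ 2 / q i

lemma chiSqDiv_nonneg (hq0 : ∀ i, 0 ≤ q i) : 0 ≤ chiSqDiv p q :=
  Finset.sum_nonneg fun i _ => div_nonneg (sq_nonneg _) (hq0 i)

lemma chiSqDiv_add_one (hq0 : ∀ i, 0 < q i) (hp : ∑ i, p i = 1) (hq : ∑ i, q i = 1) :
    chiSqDiv p q + 1 = ∑ i, p i ^ 2 / q i := by
  have expand : ∀ i, (p i - q i) ^ 2 / q i = p i ^ 2 / q i - 2 * p i + q i := fun i => by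
    have := (hq0 i).ne'
    field_simp
    ring
  simp only [chiSqDiv, expand, Finset.sum_add_distrib, Finset.sum_sub_distrib,
    ← Finset.mul_sum, hp, hq]
  ring

lemma sq_sum_abs_sub_le_chiSqDiv (hq0 : ∀ i, 0 < q i) (hq : ∑ i, q i = 1) :
    (∑ i, |p i - q i|) ^ 2 ≤ chiSqDiv p q := by
  simpa [hq, sq_abs, chiSqDiv] using
    Finset.sq_sum_div_le_sum_sq_div Finset.univ (fun i => |p i - q i|) fun i _ => hq0 i

lemma abs_sum_mul_sub_sum_mul_le {a b c : ℝ} (hp0 : ∀ i, 0 ≤ p i) (hp : ∑ i, p i = 1)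
    (hq : ∑ i, q i = 1) (ha : ∀ i, |f i - f' i| ≤ a) (hb : ∀ i, |f' i - c| ≤ b) :
    |∑ i, p i * f i - ∑ i, q i * f' i| ≤ a + (∑ i, |p i - q i|) * b := by
  have split : ∑ i, p i * f i - ∑ i, q i * f' i
      = ∑ i, p i * (f i - f' i) + ∑ i, (p i - q i) * (f' i - c) := by
    have : ∑ i, (p i - q i) * c = 0 := by
      rw [← Finset.sum_mul, Finset.sum_sub_distrib, hp, hq, sub_self, zero_mul]
    simp only [mul_sub, Finset.sum_sub_distrib, this]
    simp only [sub_mul, Finset.sum_sub_distrib]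
    ring
  rw [split]
  refine (abs_add_le _ _).trans (add_le_add ?_ ?_) <;>
    refine (Finset.abs_sum_le_sum_abs _ _).trans ?_
  · calc ∑ i, |p i * (f i - f' i)| ≤ ∑ i, p i * a := Finset.sum_le_sum fun i _ => by
          rw [abs_mul, abs_of_nonneg (hp0 i)]
          exact mul_le_mul_of_nonneg_left (ha i) (hp0 i)
      _ = a := by rw [← Finset.sum_mul, hp, one_mul]
  · rw [Finset.sum_mul]
    refine Finset.sum_le_sum fun i _ => ?_
    rw [abs_mul]
    exact mul_le_mul_of_nonneg_left (hb i) (abs_nonneg _)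

lemma mul_add_one_sub_mul_le_sum_mul {c m : ℝ} {i₀ : ι} (hq0 : ∀ i, 0 ≤ q i)
    (hq : ∑ i, q i = 1) (hc : c ≤ q i₀) (hm : ∀ i, m ≤ f i) :
    c * f i₀ + (1 - c) * m ≤ ∑ i, q i * f i := by
  have atom : c * (f i₀ - m) ≤ ∑ i, q i * (f i - m) :=
    (mul_le_mul_of_nonneg_right hc (sub_nonneg.2 (hm i₀))).trans
      (Finset.single_le_sum (f := fun i => q i * (f i - m))
        (fun i _ => mul_nonneg (hq0 i) (sub_nonneg.2 (hm i))) (Finset.mem_univ i₀))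
  simp only [mul_sub, Finset.sum_sub_distrib, ← Finset.sum_mul, hq] at atom
  linarith

lemma sum_mul_sub_sum_mul_le_of_common_atom {a b c : ℝ} {i₀ : ι} (hp0 : ∀ i, 0 ≤ p i)
    (hp : ∑ i, p i = 1) (hq0 : ∀ i, 0 ≤ q i) (hq : ∑ i, q i = 1) (hc : 0 ≤ c) (hcp : c ≤ p i₀)
    (hcq : c ≤ q i₀) (ha : f i₀ - f' i₀ ≤ a) (hb : ∀ i j, f i - f' j ≤ b) :
    ∑ i, p i * f i - ∑ i, q i * f' i ≤ c * a + (1 - c) * b := by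
  have : Nonempty ι := ⟨i₀⟩
  obtain ⟨j, hj⟩ := Finite.exists_min f'
  have upper := mul_add_one_sub_mul_le_sum_mul (f := fun i => -f i) (m := -(f' j + b)) hp0 hp hcp
    fun i => by linarith [hb i j]
  have lower := mul_add_one_sub_mul_le_sum_mul hq0 hq hcq hj
  simp only [mul_neg, Finset.sum_neg_distrib] at upper
  linarith [mul_le_mul_of_nonneg_left ha hc]

lemma exists_forall_mem_Icc_of_sub_le {α : Type*} [Nonempty α] {u : α → ℝ} {c : ℝ}
    (hu : ∀ x y, u x - u y ≤ c) : ∃ m, ∀ x, u x ∈ Set.Icc m (m + c) := by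
  have x₀ : α := Classical.arbitrary α
  have bdd : BddBelow (Set.range u) := ⟨u x₀ - c, by rintro _ ⟨x, rfl⟩; linarith [hu x₀ x]⟩
  refine ⟨⨅ x, u x, fun x => ⟨ciInf_le bdd x, ?_⟩⟩
  linarith [le_ciInf fun y => sub_le_comm.1 (hu x y)]

lemma sum_mul_exp_le {w f : ι → ℝ} {c : ℝ} (hw0 : ∀ i, 0 ≤ w i) (hw : ∑ i, w i = 1)
    (hf : ∀ i j, f i - f j ≤ c) (s : ℝ) :
    ∑ i, w i * Real.exp (s * f i)
      ≤ Real.exp (c ^ 2 * s ^ 2 / 8) * Real.exp (s * ∑ i, w i * f i) := by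
  let _ : MeasurableSpace ι := ⊤
  have : Nonempty ι := by
    by_contra h
    simp [not_nonempty_iff.1 h] at hw
  let P : PMF ι := PMF.ofFintype (fun i => ENNReal.ofReal (w i)) (by
    rw [← ENNReal.ofReal_sum_of_nonneg fun i _ => hw0 i, hw, ENNReal.ofReal_one])
  have integral_eq (G : ι → ℝ) : ∫ i, G i ∂P.toMeasure = ∑ i, w i * G i := by
    simp [PMF.integral_eq_sum, P, hw0]
  obtain ⟨m, hm⟩ := exists_forall_mem_Icc_of_sub_le hf
  have hoeffding := (hasSubgaussianMGF_of_mem_Icc (μ := P.toMeasure) (X := f)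
    (measurable_of_finite f).aemeasurable (ae_of_all _ hm)).mgf_le s
  rw [mgf, integral_eq, integral_eq] at hoeffding
  simp only [mul_sub, Real.exp_sub, ← mul_div_assoc, ← Finset.sum_div] at hoeffding
  rw [div_le_iff₀ (Real.exp_pos _)] at hoeffding
  refine hoeffding.trans_eq ?_
  congr 2
  simp only [add_sub_cancel_left, NNReal.coe_pow, NNReal.coe_div, coe_nnnorm, Real.norm_eq_abs,
    NNReal.coe_ofNat, div_pow, sq_abs]
  ring

end FiniteWeights

section Words

variable {A : Type*}

lemma consPast_mem_cylinder {x y : Past A} {k : ℕ} (hxy : x ∈ PiNat.cylinder y k) (a : A) :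
    consPast a x ∈ PiNat.cylinder (consPast a y) (k + 1) := by
  intro i hi
  cases i with
  | zero => rfl
  | succ i => exact hxy i (Nat.lt_of_succ_lt_succ hi)

lemma exists_concatPast_eq {x y : Past A} {k : ℕ} (hxy : x ∈ PiNat.cylinder y k) :
    ∃ (z : BiSeq A) (x' y' : Past A), concatPast z k x' = x ∧ concatPast z k y' = y := by
  have split (v : Past A) (z : BiSeq A) (hz : ∀ i < k, z (-((i : ℤ) + 1)) = v i) :
      concatPast z k (fun i => v (i + k)) = v := by
    funext i
    by_cases hi : i < k
    · simpa only [concatPast, if_pos hi] using hz i hi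
    · simp only [concatPast, if_neg hi, Nat.sub_add_cancel (not_lt.1 hi)]
  refine ⟨fun m => y (-m - 1).toNat, _, _, split x _ fun i hi => ?_, split y _ fun i _ => ?_⟩
  · simpa using (hxy i hi).symm
  · simp

/-- The past `x` extended by the word `w`, whose most recent letter is `w 0`. -/
def prependWord : (L : ℕ) → (Fin L → A) → Past A → Past A
  | 0, _, x => x
  | L + 1, w, x => consPast (w 0) (prependWord L (Fin.tail w) x)

/-- The probability that the chain with transition probabilities `g` produces the word `w`, whose
most recent letter is `w 0`, after the past `x`. -/
def wordProb (g : Past A → ℝ) : (L : ℕ) → (Fin L → A) → Past A → ℝ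
  | 0, _, _ => 1
  | L + 1, w, x => g (prependWord (L + 1) w x) * wordProb g L (Fin.tail w) x

lemma prependWord_mem_cylinder {x y : Past A} {k : ℕ} (hxy : x ∈ PiNat.cylinder y k) :
    ∀ (L : ℕ) (w : Fin L → A), prependWord L w x ∈ PiNat.cylinder (prependWord L w y) (k + L)
  | 0, _ => hxy
  | L + 1, w => consPast_mem_cylinder (prependWord_mem_cylinder hxy L (Fin.tail w)) (w 0)

variable {g : Past A → ℝ}

lemma pow_le_wordProb {ε : ℝ} (hε : 0 ≤ ε) (hg : ∀ x, ε ≤ g x) (x : Past A) :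
    ∀ (L : ℕ) (w : Fin L → A), ε ^ L ≤ wordProb g L w x
  | 0, _ => by simp [wordProb]
  | L + 1, w => by
    rw [pow_succ', wordProb]
    exact mul_le_mul (hg _) (pow_le_wordProb hε hg x L _) (pow_nonneg hε L) (hε.trans (hg _))

variable [Fintype A]

lemma sum_words_succ {L : ℕ} (f : (Fin (L + 1) → A) → ℝ) :
    ∑ w, f w = ∑ w : Fin L → A, ∑ a, f (Fin.cons a w) := by
  rw [← (Fin.consEquiv fun _ : Fin (L + 1) => A).sum_comp, Fintype.sum_prod_type, Finset.sum_comm]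
  rfl

/-- A `g`-function: a family of positive transition probabilities from a past to its next letter,
where `g (consPast a x)` is the probability of the letter `a` after the past `x`. -/
structure IsGFunction (g : Past A → ℝ) : Prop where
  pos : ∀ x, 0 < g x
  sum_eq_one : ∀ x, ∑ a, g (consPast a x) = 1

/-- The transfer operator of `g`: `transfer g F x` is the expectation of `F` one step after the
past `x`. -/
def transfer (g : Past A → ℝ) : Module.End ℝ (Past A → ℝ) where
  toFun F x := ∑ a, g (consPast a x) * F (consPast a x)
  map_add' F G := by
    funext x
    simp only [Pi.add_apply, mul_add, Finset.sum_add_distrib]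
  map_smul' c F := by
    funext x
    simp only [Pi.smul_apply, smul_eq_mul, RingHom.id_apply, Finset.mul_sum, mul_left_comm]

lemma transfer_apply (g F : Past A → ℝ) (x : Past A) :
    transfer g F x = ∑ a, g (consPast a x) * F (consPast a x) :=
  rfl

lemma transfer_pow_apply (g : Past A → ℝ) (x : Past A) :
    ∀ (L : ℕ) (F : Past A → ℝ),
      (transfer g ^ L) F x = ∑ w, wordProb g L w x * F (prependWord L w x)
  | 0, F => by simp [wordProb, prependWord]
  | L + 1, F => by
    rw [pow_succ, Module.End.mul_apply, transfer_pow_apply g x L, sum_words_succ]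
    simp only [transfer_apply, wordProb, prependWord, Fin.cons_zero, Fin.tail_cons,
      Finset.mul_sum, mul_left_comm, mul_assoc]

namespace IsGFunction

variable (hg : IsGFunction g)
include hg

lemma wordProb_pos (x : Past A) : ∀ (L : ℕ) (w : Fin L → A), 0 < wordProb g L w x
  | 0, _ => one_pos
  | L + 1, w => mul_pos (hg.pos _) (wordProb_pos x L (Fin.tail w))

lemma sum_wordProb (x : Past A) : ∀ L : ℕ, ∑ w, wordProb g L w x = 1
  | 0 => by simp [wordProb]
  | L + 1 => by
    simp only [sum_words_succ, wordProb, prependWord, Fin.cons_zero, Fin.tail_cons,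
      ← Finset.sum_mul, hg.sum_eq_one, one_mul, sum_wordProb x L]

lemma le_one (a : A) (x : Past A) : g (consPast a x) ≤ 1 :=
  hg.sum_eq_one x ▸ Finset.single_le_sum (f := fun a => g (consPast a x))
    (fun _ _ => (hg.pos _).le) (Finset.mem_univ a)

lemma transfer_pow_mem_Icc {F : Past A → ℝ} {m M : ℝ} (hF : ∀ x, F x ∈ Set.Icc m M) (L : ℕ)
    (x : Past A) : (transfer g ^ L) F x ∈ Set.Icc m M := by
  rw [transfer_pow_apply]
  exact (convex_Icc m M).sum_mem (fun w _ => (hg.wordProb_pos x L w).le) (hg.sum_wordProb x L)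
    fun w _ => hF _

-- The second moment of the likelihood ratio is multiplicative along a word, so the `χ²` divergence
-- over `L` letters is of the order of the sum of the one-letter divergences, and the total
-- variation distance is of the order of its square root.
lemma chiSqDiv_wordProb_add_one_le {u : ℝ} {k : ℕ} {x y : Past A}
    (hu : ∀ j, k ≤ j → ∀ x' y' : Past A, x' ∈ PiNat.cylinder y' j →
      chiSqDiv (fun a => g (consPast a x')) (fun a => g (consPast a y')) ≤ u)
    (hxy : x ∈ PiNat.cylinder y k) :
    ∀ L : ℕ, chiSqDiv (fun w => wordProb g L w x) (fun w => wordProb g L w y) + 1 ≤ (1 + u) ^ L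
  | 0 => by simp [chiSqDiv, wordProb]
  | L + 1 => by
    have ih := chiSqDiv_wordProb_add_one_le hu hxy L
    rw [chiSqDiv_add_one (hg.wordProb_pos y _) (hg.sum_wordProb x _) (hg.sum_wordProb y _)]
      at ih ⊢
    have letter (w : Fin L → A) : ∑ a, g (consPast a (prependWord L w x)) ^ 2
        / g (consPast a (prependWord L w y)) ≤ 1 + u := by
      rw [← chiSqDiv_add_one (fun _ => hg.pos _) (hg.sum_eq_one _) (hg.sum_eq_one _)]
      linarith [hu _ (Nat.le_add_right k L) _ _ (prependWord_mem_cylinder hxy L w)]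
    have u_nonneg : 0 ≤ u :=
      (chiSqDiv_nonneg fun _ => (hg.pos _).le).trans (hu k le_rfl x y hxy)
    calc _ = ∑ w, (wordProb g L w x ^ 2 / wordProb g L w y) * ∑ a,
          g (consPast a (prependWord L w x)) ^ 2 / g (consPast a (prependWord L w y)) := by
          simp only [sum_words_succ, wordProb, prependWord, Fin.cons_zero, Fin.tail_cons,
            mul_pow, mul_div_mul_comm, ← Finset.sum_mul, mul_comm]
      _ ≤ ∑ w, (wordProb g L w x ^ 2 / wordProb g L w y) * (1 + u) :=
          Finset.sum_le_sum fun w _ => mul_le_mul_of_nonneg_left (letter w)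
            (div_nonneg (sq_nonneg _) (hg.wordProb_pos y L w).le)
      _ ≤ (1 + u) ^ (L + 1) := by
          rw [← Finset.sum_mul, pow_succ]
          exact mul_le_mul_of_nonneg_right ih (by linarith)

lemma sum_abs_wordProb_sub_le {u p : ℝ} (hp : 0 ≤ p) {k L : ℕ} {x y : Past A}
    (hu : ∀ j, k ≤ j → ∀ x' y' : Past A, x' ∈ PiNat.cylinder y' j →
      chiSqDiv (fun a => g (consPast a x')) (fun a => g (consPast a y')) ≤ u)
    (hpL : Real.exp (L * u) - 1 ≤ p ^ 2) (hxy : x ∈ PiNat.cylinder y k) :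
    ∑ w, |wordProb g L w x - wordProb g L w y| ≤ p := by
  have u_nonneg : 0 ≤ u :=
    (chiSqDiv_nonneg fun _ => (hg.pos _).le).trans (hu k le_rfl x y hxy)
  have pow_le_exp : (1 + u) ^ L ≤ Real.exp (L * u) := by
    rw [Real.exp_nat_mul]
    exact pow_le_pow_left₀ (by linarith) (by linarith [Real.add_one_le_exp u]) L
  refine abs_le_of_sq_le_sq' ?_ hp |>.2
  calc _ ≤ chiSqDiv (fun w => wordProb g L w x) (fun w => wordProb g L w y) :=
        sq_sum_abs_sub_le_chiSqDiv (hg.wordProb_pos y L) (hg.sum_wordProb y L)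
    _ ≤ p ^ 2 := by linarith [hg.chiSqDiv_wordProb_add_one_le hu hxy L]

end IsGFunction

end Words

section Variation

variable {A : Type*} {F : Past A → ℝ} {m M : ℝ} {k : ℕ}

/-- The `k`-th variation of `F`: its oscillation over the pairs of pasts with the same `k` most
recent letters. It is meant for bounded `F`, the supremum being `0` otherwise. -/
def variation (F : Past A → ℝ) (k : ℕ) : ℝ :=
  ⨆ q : {q : Past A × Past A // q.1 ∈ PiNat.cylinder q.2 k}, |F q.1.1 - F q.1.2|

lemma variation_nonneg (F : Past A → ℝ) (k : ℕ) : 0 ≤ variation F k :=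
  Real.iSup_nonneg fun _ => abs_nonneg _

lemma variation_le {B : ℝ} (hB : 0 ≤ B)
    (h : ∀ x y : Past A, x ∈ PiNat.cylinder y k → F x - F y ≤ B) : variation F k ≤ B :=
  Real.iSup_le (fun q => abs_sub_le_iff.2
    ⟨h _ _ q.2, h _ _ ((PiNat.mem_cylinder_comm _ _ _).1 q.2)⟩) hB

lemma abs_sub_le_variation (hF : ∀ x, F x ∈ Set.Icc m M) {x y : Past A}
    (hxy : x ∈ PiNat.cylinder y k) : |F x - F y| ≤ variation F k :=
  le_ciSup (f := fun q : {q : Past A × Past A // q.1 ∈ PiNat.cylinder q.2 k} =>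
      |F q.1.1 - F q.1.2|)
    ⟨M - m, by rintro _ ⟨q, rfl⟩; exact Real.dist_le_of_mem_Icc (hF _) (hF _)⟩ ⟨(x, y), hxy⟩

lemma abs_sub_le_variation_zero (hF : ∀ x, F x ∈ Set.Icc m M) (x y : Past A) :
    |F x - F y| ≤ variation F 0 :=
  abs_sub_le_variation hF (PiNat.cylinder_zero y ▸ Set.mem_univ x)

lemma variation_le_sub [Nonempty A] (hF : ∀ x, F x ∈ Set.Icc m M) (k : ℕ) :
    variation F k ≤ M - m :=
  have x : Past A := fun _ => Classical.arbitrary A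
  variation_le (sub_nonneg.2 ((hF x).1.trans (hF x).2)) fun x y _ =>
    (le_abs_self _).trans (Real.dist_le_of_mem_Icc (hF x) (hF y))

lemma variation_comp_head (h : A → ℝ) (hk : 0 < k) : variation (fun x => h (x 0)) k = 0 :=
  (variation_le le_rfl fun _ _ hxy => by rw [hxy 0 hk, sub_self]).antisymm (variation_nonneg _ _)

namespace IsGFunction

variable [Fintype A] {g : Past A → ℝ} (hg : IsGFunction g)
include hg

-- Run the chains from two pasts together for `L` steps: they produce the same word, and so agree
-- on `L` more letters, except with probability `p`.
lemma variation_transfer_pow_le {p : ℝ} (hF : ∀ x, F x ∈ Set.Icc m M) {L : ℕ}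
    (hTV : ∀ x y : Past A, x ∈ PiNat.cylinder y k →
      ∑ w, |wordProb g L w x - wordProb g L w y| ≤ p) (hp : 0 ≤ p) :
    variation ((transfer g ^ L) F) k ≤ variation F (k + L) + p * variation F 0 := by
  refine variation_le (add_nonneg (variation_nonneg _ _) (mul_nonneg hp (variation_nonneg _ _)))
    fun x y hxy => (le_abs_self _).trans ?_
  rw [transfer_pow_apply, transfer_pow_apply]
  refine (abs_sum_mul_sub_sum_mul_le (c := F x) (fun w => (hg.wordProb_pos x L w).le)
    (hg.sum_wordProb x L) (hg.sum_wordProb y L)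
    (fun w => abs_sub_le_variation hF (prependWord_mem_cylinder hxy L w))
    fun w => abs_sub_le_variation_zero hF _ _).trans ?_
  gcongr
  · exact variation_nonneg _ _
  · exact hTV x y hxy

lemma variation_transfer_pow_zero_le [Nonempty A] {ε : ℝ} (hε : 0 ≤ ε) (hgε : ∀ x, ε ≤ g x)
    (hF : ∀ x, F x ∈ Set.Icc m M) (L : ℕ) :
    variation ((transfer g ^ L) F) 0
      ≤ ε ^ L * variation F L + (1 - ε ^ L) * variation F 0 := by
  have a : A := Classical.arbitrary A
  have pow_le_one : ε ^ L ≤ 1 :=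
    pow_le_one₀ hε ((hgε _).trans (hg.le_one a fun _ => a))
  refine variation_le (add_nonneg (mul_nonneg (pow_nonneg hε L) (variation_nonneg _ _))
    (mul_nonneg (sub_nonneg.2 pow_le_one) (variation_nonneg _ _))) fun x y hxy => ?_
  rw [transfer_pow_apply, transfer_pow_apply]
  refine sum_mul_sub_sum_mul_le_of_common_atom (i₀ := fun _ => a)
    (fun w => (hg.wordProb_pos x L w).le) (hg.sum_wordProb x L)
    (fun w => (hg.wordProb_pos y L w).le) (hg.sum_wordProb y L) (pow_nonneg hε L)
    (pow_le_wordProb hε hgε x L _) (pow_le_wordProb hε hgε y L _) ?_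
    fun w w' => (le_abs_self _).trans (abs_sub_le_variation_zero hF _ _)
  have agree := prependWord_mem_cylinder hxy L fun _ => a
  rw [Nat.zero_add] at agree
  exact (le_abs_self _).trans (abs_sub_le_variation hF agree)

end IsGFunction

end Variation

section Recursion

variable {γ : ℕ → ℕ → ℝ} {L : ℕ → ℕ} {p Q : ℕ → ℝ} {R D : ℝ} {n : ℕ}

lemma sum_range_le_of_le_block {k m : ℕ} (hγR : γ 0 0 ≤ R) (hγ : ∀ i, k ≤ i → γ i 0 = 0)
    (hblock : ∀ l ≤ m, γ k l ≤ γ (k + l) 0 + p k * γ 0 0) (hmD : (m : ℝ) ≤ D) (hp : 0 ≤ p k)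
    (hR : 0 ≤ R) : ∑ j ∈ Finset.range m, γ k j ≤ p k * (D * R) :=
  calc ∑ j ∈ Finset.range m, γ k j ≤ ∑ _j ∈ Finset.range m, p k * R := by
        refine Finset.sum_le_sum fun j hj => (hblock j (Finset.mem_range.1 hj).le).trans ?_
        rw [hγ (k + j) (Nat.le_add_right k j), zero_add]
        exact mul_le_mul_of_nonneg_left hγR hp
    _ = p k * (m * R) := by
        rw [Finset.sum_const, Finset.card_range, nsmul_eq_mul, mul_left_comm]
    _ ≤ p k * (D * R) := by gcongr

variable (hγ0 : ∀ k j, 0 ≤ γ k j) (hγR : ∀ j, γ 0 j ≤ R)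
include hγ0 hγR

-- Here `γ k j` plays the role of the `k`-th variation of a function propagated for `j` steps, `p k`
-- of the probability of failing to match a block of `L k` letters after `k` common letters, and
-- `Q k` of the probability that this ever happens in one of the successive blocks.
lemma sum_range_le_of_block_recursion (hγ : ∀ k, 1 ≤ k → γ k 0 = 0)
    (hblock : ∀ k, 1 ≤ k → ∀ l ≤ L k, ∀ j, γ k (j + l) ≤ γ (k + l) j + p k * γ 0 j)
    (hL : ∀ k, 1 ≤ k → 1 ≤ L k) (hLD : ∀ k ≤ n, (L k : ℝ) ≤ D) (hp : ∀ k, 0 ≤ p k)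
    (hQ0 : ∀ k, 0 ≤ Q k) (hpQ : ∀ k, 1 ≤ k → p k + Q (k + L k) ≤ Q k) (m : ℕ) :
    ∀ k, 1 ≤ k → k + m ≤ n →
      ∑ j ∈ Finset.range m, γ k j ≤ Q k * (D * R + ∑ j ∈ Finset.range n, γ 0 j) := by
  induction m using Nat.strong_induction_on with
  | _ m ih =>
  intro k hk hkm
  set S := ∑ j ∈ Finset.range n, γ 0 j
  have hR : 0 ≤ R := (hγ0 0 0).trans (hγR 0)
  have hDR : 0 ≤ D * R := mul_nonneg ((Nat.cast_nonneg _).trans (hLD k (by lia))) hR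
  have hS : 0 ≤ S := Finset.sum_nonneg fun j _ => hγ0 0 j
  have first_block (l : ℕ) (hl : l ≤ L k) : ∑ j ∈ Finset.range l, γ k j ≤ p k * (D * R) :=
    sum_range_le_of_le_block (hγR 0) (fun i hi => hγ i (hk.trans hi))
      (fun i hi => by simpa using hblock k hk i (hi.trans hl) 0)
      ((Nat.cast_le.2 hl).trans (hLD k (by lia))) (hp k) hR
  rcases le_total m (L k) with hmL | hmL
  · have : p k ≤ Q k := by linarith [hpQ k hk, hQ0 (k + L k)]
    calc _ ≤ p k * (D * R) := first_block m hmL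
      _ ≤ Q k * (D * R + S) := mul_le_mul this (le_add_of_nonneg_right hS) hDR (hQ0 k)
  · obtain ⟨i, rfl⟩ := Nat.exists_eq_add_of_le hmL
    have later_blocks : ∑ j ∈ Finset.range i, γ k (L k + j)
        ≤ ∑ j ∈ Finset.range i, γ (k + L k) j + p k * S :=
      calc _ ≤ ∑ j ∈ Finset.range i, (γ (k + L k) j + p k * γ 0 j) :=
            Finset.sum_le_sum fun j _ => add_comm j (L k) ▸ hblock k hk (L k) le_rfl j
        _ ≤ _ := by
            rw [Finset.sum_add_distrib, ← Finset.mul_sum]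
            exact add_le_add_right (mul_le_mul_of_nonneg_left
              (Finset.sum_le_sum_of_subset_of_nonneg (Finset.range_mono (by lia))
                fun j _ _ => hγ0 0 j) (hp k)) _
    have rest := ih i (by have := hL k hk; lia) (k + L k) (by lia) (by lia)
    rw [Finset.sum_range_add]
    linarith [first_block (L k) le_rfl, mul_le_mul_of_nonneg_right (hpQ k hk) (add_nonneg hDR hS)]

-- From no common letters, `k₀` letters are matched within `k₀` steps with probability at least `c`,
-- and `hmemory` says that they are then lost with probability at most `1 / 2`.
lemma sum_range_zero_le_of_restart {c : ℝ} {k₀ : ℕ} (hc0 : 0 < c) (hc1 : c ≤ 1) (hD : 0 ≤ D)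
    (hmemory : k₀ ≤ n → ∑ j ∈ Finset.range (n - k₀), γ k₀ j
      ≤ 1 / 2 * (D * R + ∑ j ∈ Finset.range n, γ 0 j))
    (hrestart : ∀ j, γ 0 (j + k₀) ≤ c * γ k₀ j + (1 - c) * γ 0 j) :
    ∑ j ∈ Finset.range n, γ 0 j ≤ (2 * k₀ / c + D) * R := by
  set S := ∑ j ∈ Finset.range n, γ 0 j
  have hR : 0 ≤ R := (hγ0 0 0).trans (hγR 0)
  have start (l : ℕ) (hl : l ≤ k₀) : ∑ j ∈ Finset.range l, γ 0 j ≤ k₀ * R :=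
    calc _ ≤ l * R := by simpa using Finset.sum_le_card_nsmul (Finset.range l) _ R fun j _ => hγR j
      _ ≤ k₀ * R := by gcongr
  suffices c * S ≤ 2 * (k₀ * R) + c * (D * R) by
    rw [← mul_le_mul_iff_right₀ hc0]
    refine this.trans_eq ?_
    field_simp
  have hDR : 0 ≤ c * (D * R) := by positivity
  rcases le_total n k₀ with hn | hn
  · have : c * S ≤ S := mul_le_of_le_one_left (Finset.sum_nonneg fun j _ => hγ0 0 j) hc1
    linarith [start n hn, mul_nonneg k₀.cast_nonneg hR]
  · have after_restart : ∑ j ∈ Finset.range (n - k₀), γ 0 (k₀ + j)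
        ≤ c * ∑ j ∈ Finset.range (n - k₀), γ k₀ j + (1 - c) * S :=
      calc _ ≤ ∑ j ∈ Finset.range (n - k₀), (c * γ k₀ j + (1 - c) * γ 0 j) :=
            Finset.sum_le_sum fun j _ => add_comm j k₀ ▸ hrestart j
        _ ≤ _ := by
            rw [Finset.sum_add_distrib, ← Finset.mul_sum, ← Finset.mul_sum]
            exact add_le_add_right (mul_le_mul_of_nonneg_left
              (Finset.sum_le_sum_of_subset_of_nonneg (Finset.range_mono (by lia))
                fun j _ _ => hγ0 0 j) (sub_nonneg.2 hc1)) _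
    have split : S = ∑ j ∈ Finset.range k₀, γ 0 j + ∑ j ∈ Finset.range (n - k₀), γ 0 (k₀ + j) := by
      rw [← Finset.sum_range_add, Nat.add_sub_cancel' hn]
    linarith [start k₀ le_rfl, mul_le_mul_of_nonneg_left (hmemory hn) hc0.le]

end Recursion

section Blocks

/-- The length of the block of letters that the coupling tries to match when the `k` most recent
letters agree. -/
def blockLength (ρ : ℝ) (k : ℕ) : ℕ := ⌈(k : ℝ) ^ (1 - ρ)⌉₊

/-- A bound on the probability of failing to match a block of `blockLength ρ k` letters when the
`k` most recent letters agree, for a `χ²`-variation rate of at most `C / k ^ (1 + δ)`. -/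
def blockFailure (C ρ δ : ℝ) (k : ℕ) : ℝ :=
  √(2 * C * Real.exp (2 * C)) * (k : ℝ) ^ (-((ρ + δ) / 2))

/-- A bound on the probability that one of the successive blocks that start with `k` matched
letters fails. -/
def failureTail (C ρ δ : ℝ) (k : ℕ) : ℝ :=
  √(2 * C * Real.exp (2 * C)) * 2 ^ (1 + (δ - ρ) / 2)
    * ∑' s : ℕ, ((s + k : ℕ) : ℝ) ^ (-(1 + (δ - ρ) / 2))

variable {C ρ δ : ℝ} {k : ℕ}

lemma rpow_le_blockLength (ρ : ℝ) (k : ℕ) : (k : ℝ) ^ (1 - ρ) ≤ blockLength ρ k :=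
  Nat.le_ceil _

lemma one_le_blockLength (ρ : ℝ) (hk : 1 ≤ k) : 1 ≤ blockLength ρ k :=
  Nat.one_le_ceil_iff.2 (Real.rpow_pos_of_pos (by exact_mod_cast hk) _)

lemma blockLength_le (hρ0 : 0 ≤ ρ) (hk : 1 ≤ k) : blockLength ρ k ≤ k :=
  Nat.ceil_le.2 <| (Real.rpow_le_rpow_of_exponent_le (by exact_mod_cast hk)
    (by linarith : 1 - ρ ≤ 1)).trans_eq (Real.rpow_one _)

lemma blockLength_le_two_mul_rpow {n : ℕ} (hρ1 : ρ ≤ 1) (hkn : k ≤ n) (hn : 1 ≤ n) :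
    (blockLength ρ k : ℝ) ≤ 2 * (n : ℝ) ^ (1 - ρ) := by
  have one_le : 1 ≤ (n : ℝ) ^ (1 - ρ) :=
    Real.one_le_rpow (by exact_mod_cast hn) (by linarith)
  have mono : (k : ℝ) ^ (1 - ρ) ≤ (n : ℝ) ^ (1 - ρ) := by gcongr
  have ceil : (blockLength ρ k : ℝ) < (k : ℝ) ^ (1 - ρ) + 1 :=
    Nat.ceil_lt_add_one (by positivity)
  linarith

lemma blockFailure_nonneg (C ρ δ : ℝ) (k : ℕ) : 0 ≤ blockFailure C ρ δ k := by
  unfold blockFailure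
  positivity

lemma failureTail_nonneg (C ρ δ : ℝ) (k : ℕ) : 0 ≤ failureTail C ρ δ k := by
  unfold failureTail
  positivity

lemma tendsto_failureTail (C ρ δ : ℝ) : Tendsto (failureTail C ρ δ) atTop (𝓝 0) := by
  simpa only [mul_zero, failureTail] using!
    (tendsto_sum_nat_add fun s : ℕ => (s : ℝ) ^ (-(1 + (δ - ρ) / 2))).const_mul
      (√(2 * C * Real.exp (2 * C)) * 2 ^ (1 + (δ - ρ) / 2))

lemma exp_sub_one_le_mul_exp (s : ℝ) : Real.exp s - 1 ≤ s * Real.exp s := by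
  have := mul_le_mul_of_nonneg_right (Real.add_one_le_exp (-s)) (Real.exp_pos s).le
  rw [← Real.exp_add, neg_add_cancel, Real.exp_zero] at this
  linarith

lemma exp_blockLength_mul_sub_one_le_sq (hC : 0 ≤ C) (hρ0 : 0 ≤ ρ) (hρ1 : ρ ≤ 1) (hδ : 0 ≤ δ)
    (hk : 1 ≤ k) :
    Real.exp (blockLength ρ k * (C / (k : ℝ) ^ (1 + δ))) - 1 ≤ blockFailure C ρ δ k ^ 2 := by
  have hk1 : (1 : ℝ) ≤ k := by exact_mod_cast hk
  have hk0 : (0 : ℝ) < k := by linarith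
  set s := blockLength ρ k * (C / (k : ℝ) ^ (1 + δ))
  have hs : s ≤ 2 * C * (k : ℝ) ^ (-(ρ + δ)) :=
    calc s ≤ 2 * (k : ℝ) ^ (1 - ρ) * (C / (k : ℝ) ^ (1 + δ)) :=
          mul_le_mul_of_nonneg_right (blockLength_le_two_mul_rpow hρ1 le_rfl hk) (by positivity)
      _ = 2 * C * ((k : ℝ) ^ (1 - ρ) / (k : ℝ) ^ (1 + δ)) := by ring
      _ = 2 * C * (k : ℝ) ^ (-(ρ + δ)) := by
          rw [← Real.rpow_sub hk0]
          ring_nf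
  have hs2C : s ≤ 2 * C :=
    hs.trans (mul_le_of_le_one_right (by positivity)
      (Real.rpow_le_one_of_one_le_of_nonpos hk1 (by linarith)))
  calc Real.exp s - 1 ≤ s * Real.exp s := exp_sub_one_le_mul_exp s
    _ ≤ 2 * C * (k : ℝ) ^ (-(ρ + δ)) * Real.exp (2 * C) := by gcongr
    _ = blockFailure C ρ δ k ^ 2 := by
        rw [blockFailure, mul_pow, Real.sq_sqrt (by positivity), ← Real.rpow_mul_natCast hk0.le]
        ring_nf

-- The block length is chosen so that, up to a constant, a block covers enough of the convergent
-- series `∑ s ^ (-(1 + (δ - ρ) / 2))` to pay for its own failure.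
lemma rpow_le_two_rpow_mul_sum_block (hρ0 : 0 ≤ ρ) (hρδ : ρ ≤ δ) (hk : 1 ≤ k) :
    (k : ℝ) ^ (-((ρ + δ) / 2)) ≤ 2 ^ (1 + (δ - ρ) / 2)
      * ∑ s ∈ Finset.range (blockLength ρ k), ((s + k : ℕ) : ℝ) ^ (-(1 + (δ - ρ) / 2)) := by
  have hk0 : (0 : ℝ) < k := by exact_mod_cast hk
  set r := 1 + (δ - ρ) / 2
  calc (k : ℝ) ^ (-((ρ + δ) / 2)) = 2 ^ r * ((k : ℝ) ^ (1 - ρ) * (2 * k) ^ (-r)) := by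
        rw [Real.mul_rpow zero_le_two hk0.le, mul_left_comm (_ ^ (1 - ρ)), ← mul_assoc,
          ← Real.rpow_add two_pos, ← Real.rpow_add hk0, add_neg_cancel, Real.rpow_zero, one_mul]
        congr 1
        ring
    _ ≤ 2 ^ r * (blockLength ρ k * (2 * k) ^ (-r)) := by
        gcongr
        exact rpow_le_blockLength ρ k
    _ ≤ 2 ^ r * ∑ s ∈ Finset.range (blockLength ρ k), ((s + k : ℕ) : ℝ) ^ (-r) := by
        gcongr
        have term (s : ℕ) (hs : s ∈ Finset.range (blockLength ρ k)) :
            (2 * k : ℝ) ^ (-r) ≤ ((s + k : ℕ) : ℝ) ^ (-r) := by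
          have : s < blockLength ρ k := Finset.mem_range.1 hs
          have : s + k ≤ 2 * k := by have := blockLength_le hρ0 hk; lia
          exact Real.rpow_le_rpow_of_nonpos (by positivity) (by exact_mod_cast this)
            (by simp only [r]; linarith)
        simpa using Finset.card_nsmul_le_sum _ _ _ term

lemma blockFailure_add_failureTail_le (hρ0 : 0 ≤ ρ) (hρδ : ρ < δ) (hk : 1 ≤ k) :
    blockFailure C ρ δ k + failureTail C ρ δ (k + blockLength ρ k) ≤ failureTail C ρ δ k := by
  have block := rpow_le_two_rpow_mul_sum_block hρ0 hρδ.le hk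
  have summable : Summable fun s : ℕ => ((s + k : ℕ) : ℝ) ^ (-(1 + (δ - ρ) / 2)) :=
    (summable_nat_add_iff k).2 (Real.summable_nat_rpow.2 (by linarith))
  have tail := summable.sum_add_tsum_nat_add (blockLength ρ k)
  simp only [add_assoc, add_comm (blockLength ρ k) k] at tail
  rw [failureTail, failureTail, blockFailure, ← tail]
  linarith [mul_le_mul_of_nonneg_left block (Real.sqrt_nonneg (2 * C * Real.exp (2 * C)))]

end Blocks

namespace IsGFunction

variable {A : Type*} [Fintype A] {g F : Past A → ℝ} {C ρ δ ε m M : ℝ} (hg : IsGFunction g)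
  (hχ : ∀ k : ℕ, 1 ≤ k → ∀ x y : Past A, x ∈ PiNat.cylinder y k →
    chiSqDiv (fun a => g (consPast a x)) (fun a => g (consPast a y)) ≤ C / (k : ℝ) ^ (1 + δ))
include hg hχ

lemma variation_transfer_pow_le_of_le_blockLength (hC : 0 ≤ C) (hρ0 : 0 ≤ ρ) (hρ1 : ρ ≤ 1)
    (hδ : 0 ≤ δ) (hF : ∀ x, F x ∈ Set.Icc m M) {k l : ℕ} (hk : 1 ≤ k)
    (hl : l ≤ blockLength ρ k) :
    variation ((transfer g ^ l) F) k
      ≤ variation F (k + l) + blockFailure C ρ δ k * variation F 0 := by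
  have : (0 : ℝ) < k := by exact_mod_cast hk
  refine hg.variation_transfer_pow_le hF (fun x y hxy => ?_) (blockFailure_nonneg C ρ δ k)
  refine hg.sum_abs_wordProb_sub_le (u := C / (k : ℝ) ^ (1 + δ)) (blockFailure_nonneg C ρ δ k)
    (fun j hj x' y' hxy' => (hχ j (hk.trans hj) x' y' hxy').trans ?_) (le_trans ?_
      (exp_blockLength_mul_sub_one_le_sq hC hρ0 hρ1 hδ hk)) hxy
  · gcongr
  · gcongr

lemma sum_variation_transfer_pow_le [Nonempty A] (hC : 0 ≤ C) (hρ0 : 0 ≤ ρ) (hρ1 : ρ ≤ 1)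
    (hρδ : ρ < δ) (hF : ∀ x, F x ∈ Set.Icc m M) (hF1 : ∀ k, 1 ≤ k → variation F k = 0) {k l n : ℕ}
    (hk : 1 ≤ k) (hkln : k + l ≤ n) :
    ∑ j ∈ Finset.range l, variation ((transfer g ^ j) F) k
      ≤ failureTail C ρ δ k * (2 * (n : ℝ) ^ (1 - ρ) * (M - m)
        + ∑ j ∈ Finset.range n, variation ((transfer g ^ j) F) 0) :=
  sum_range_le_of_block_recursion (γ := fun k j => variation ((transfer g ^ j) F) k)
    (fun _ _ => variation_nonneg _ _)
    (fun j => variation_le_sub (hg.transfer_pow_mem_Icc hF j) 0) hF1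
    (fun i hi l hl j => by
      simpa only [add_comm j l, pow_add, Module.End.mul_apply] using
        hg.variation_transfer_pow_le_of_le_blockLength hχ hC hρ0 hρ1 (hρ0.trans hρδ.le)
          (hg.transfer_pow_mem_Icc hF j) hi hl)
    (fun _ => one_le_blockLength ρ)
    (fun _ hi => blockLength_le_two_mul_rpow hρ1 hi (by lia))
    (blockFailure_nonneg C ρ δ) (failureTail_nonneg C ρ δ)
    (fun _ => blockFailure_add_failureTail_le hρ0 hρδ) l k hk hkln

lemma sum_variation_transfer_pow_zero_le [Nonempty A] (hC : 0 ≤ C) (hρ0 : 0 ≤ ρ) (hρ1 : ρ ≤ 1)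
    (hρδ : ρ < δ) (hε : 0 < ε) (hgε : ∀ x, ε ≤ g x) {k₀ : ℕ} (hk₀ : 1 ≤ k₀)
    (htail : failureTail C ρ δ k₀ ≤ 1 / 2) (hF : ∀ x, F x ∈ Set.Icc m M)
    (hF1 : ∀ k, 1 ≤ k → variation F k = 0) {n : ℕ} (hn : 1 ≤ n) :
    ∑ j ∈ Finset.range n, variation ((transfer g ^ j) F) 0
      ≤ (2 * k₀ / ε ^ k₀ + 2) * (n : ℝ) ^ (1 - ρ) * (M - m) := by
  have a : A := Classical.arbitrary A
  have hmM : 0 ≤ M - m := sub_nonneg.2 ((hF fun _ => a).1.trans (hF fun _ => a).2)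
  have hε1 : ε ≤ 1 := (hgε _).trans (hg.le_one a fun _ => a)
  have one_le : 1 ≤ (n : ℝ) ^ (1 - ρ) := Real.one_le_rpow (by exact_mod_cast hn) (by linarith)
  have memory (hn₀ : k₀ ≤ n) : ∑ j ∈ Finset.range (n - k₀), variation ((transfer g ^ j) F) k₀
      ≤ 1 / 2 * (2 * (n : ℝ) ^ (1 - ρ) * (M - m)
        + ∑ j ∈ Finset.range n, variation ((transfer g ^ j) F) 0) :=
    (hg.sum_variation_transfer_pow_le hχ hC hρ0 hρ1 hρδ hF hF1 hk₀ (by lia)).trans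
      (mul_le_mul_of_nonneg_right htail (add_nonneg (by positivity)
        (Finset.sum_nonneg fun _ _ => variation_nonneg _ _)))
  have restart (j : ℕ) : variation ((transfer g ^ (j + k₀)) F) 0
      ≤ ε ^ k₀ * variation ((transfer g ^ j) F) k₀
        + (1 - ε ^ k₀) * variation ((transfer g ^ j) F) 0 := by
    simpa only [add_comm j k₀, pow_add, Module.End.mul_apply] using
      hg.variation_transfer_pow_zero_le hε.le hgε (hg.transfer_pow_mem_Icc hF j) k₀
  calc _ ≤ (2 * k₀ / ε ^ k₀ + 2 * (n : ℝ) ^ (1 - ρ)) * (M - m) :=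
        sum_range_zero_le_of_restart (γ := fun k j => variation ((transfer g ^ j) F) k)
          (fun _ _ => variation_nonneg _ _)
          (fun j => variation_le_sub (hg.transfer_pow_mem_Icc hF j) 0)
          (pow_pos hε k₀) (pow_le_one₀ hε.le hε1) (by positivity) memory restart
    _ ≤ (2 * k₀ / ε ^ k₀ + 2) * (n : ℝ) ^ (1 - ρ) * (M - m) := by
        refine mul_le_mul_of_nonneg_right ?_ hmM
        rw [add_mul]
        gcongr
        exact le_mul_of_one_le_right (by positivity) one_le

end IsGFunction

section Concentration

variable {A : Type*}

/-- The shift on pasts, which forgets the most recent letter. -/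
def shift (x : Past A) : Past A := fun i => x (i + 1)

lemma shift_consPast (a : A) (x : Past A) : shift (consPast a x) = x := rfl

lemma pastOf_add_one (n : ℤ) (ω : BiSeq A) :
    pastOf (n + 1) ω = consPast (ω (n + 1)) (pastOf n ω) := by
  funext i
  cases i with
  | zero => simp only [pastOf, consPast, Nat.cast_zero, sub_zero]
  | succ i =>
    simp only [pastOf, consPast]
    congr 1
    push_cast
    ring

lemma birkhoffSum_shift_pastOf (h : A → ℝ) (ω : BiSeq A) :
    ∀ n : ℕ, birkhoffSum shift (fun x => h (x 0)) n (pastOf n ω)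
      = ∑ i ∈ Finset.Icc 1 n, h (ω (i : ℤ))
  | 0 => by simp
  | n + 1 => by
    rw [birkhoffSum_succ', Nat.cast_succ, pastOf_add_one, shift_consPast,
      birkhoffSum_shift_pastOf h ω n, Finset.sum_Icc_succ_top (by lia), add_comm, Nat.cast_succ]
    rfl

lemma measurable_pastOf [MeasurableSpace A] (n : ℤ) : Measurable (pastOf (A := A) n) :=
  measurable_pi_lambda _ fun _ => measurable_pi_apply _

lemma measurable_shift [MeasurableSpace A] : Measurable (shift (A := A)) :=
  measurable_pi_lambda _ fun _ => measurable_pi_apply _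

lemma measurable_consPast [MeasurableSpace A] (a : A) : Measurable (consPast a) := by
  refine measurable_pi_lambda _ fun i => ?_
  cases i with
  | zero => exact measurable_const
  | succ i => exact measurable_pi_apply i

variable [Fintype A] {g F : Past A → ℝ}

lemma measurable_transfer_pow [MeasurableSpace A] (hg : Measurable g) (hF : Measurable F) :
    ∀ L : ℕ, Measurable ((transfer g ^ L) F)
  | 0 => hF
  | L + 1 => by
    rw [pow_succ', Module.End.mul_apply]
    exact Finset.measurable_sum _ fun a _ => (hg.comp (measurable_consPast a)).mul
      ((measurable_transfer_pow hg hF L).comp (measurable_consPast a))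

namespace IsGFunction

variable (hg : IsGFunction g)
include hg

lemma transfer_comp_shift (F : Past A → ℝ) : transfer g (F ∘ shift) = F := by
  funext x
  simp only [transfer_apply, Function.comp_apply, shift_consPast, ← Finset.sum_mul,
    hg.sum_eq_one, one_mul]

lemma transfer_pow_birkhoffSum (f : Past A → ℝ) (i : ℕ) :
    ∀ k : ℕ, (transfer g ^ k) (birkhoffSum shift f (k + i + 1))
      = ∑ j ∈ Finset.range (k + 1), (transfer g ^ j) f + birkhoffSum shift f i ∘ shift
  | 0 => by
    funext x
    simp [birkhoffSum_succ']
  | k + 1 => by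
    have split : birkhoffSum shift f (k + 1 + i + 1)
        = f + birkhoffSum shift f (k + i + 1) ∘ shift := by
      funext x
      rw [birkhoffSum_succ', Pi.add_apply, Function.comp_apply, Nat.add_right_comm k 1 i]
    rw [pow_succ, Module.End.mul_apply, split, map_add, hg.transfer_comp_shift, map_add,
      transfer_pow_birkhoffSum f i k, ← Module.End.mul_apply, ← pow_succ,
      Finset.sum_range_succ _ (k + 1)]
    abel

lemma sum_transfer_pow_sub_le {f : Past A → ℝ} {m M : ℝ} (hf : ∀ x, f x ∈ Set.Icc m M)
    {k n : ℕ} (hk : k ≤ n) (x y : Past A) :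
    ∑ j ∈ Finset.range k, (transfer g ^ j) f x - ∑ j ∈ Finset.range k, (transfer g ^ j) f y
      ≤ ∑ j ∈ Finset.range n, variation ((transfer g ^ j) f) 0 := by
  rw [← Finset.sum_sub_distrib]
  calc _ ≤ ∑ j ∈ Finset.range k, variation ((transfer g ^ j) f) 0 :=
        Finset.sum_le_sum fun j _ => (le_abs_self _).trans
          (abs_sub_le_variation_zero (hg.transfer_pow_mem_Icc hf j) x y)
    _ ≤ _ := Finset.sum_le_sum_of_subset_of_nonneg (Finset.range_mono hk)
        fun _ _ _ => variation_nonneg _ _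

-- The expectations of `G` given more and more letters form a martingale, and Hoeffding's lemma
-- bounds the contribution of each of its increments.
lemma transfer_pow_exp_le {G : Past A → ℝ} {c : ℝ} (s : ℝ) :
    ∀ {L : ℕ}, (∀ k < L, ∀ (a b : A) (x : Past A),
      (transfer g ^ k) G (consPast a x) - (transfer g ^ k) G (consPast b x) ≤ c) →
    ∀ x, (transfer g ^ L) (fun y => Real.exp (s * G y)) x
      ≤ Real.exp (L * (c ^ 2 * s ^ 2 / 8)) * Real.exp (s * (transfer g ^ L) G x)
  | 0, _, x => by simp
  | L + 1, hc, x => by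
    rw [pow_succ', Module.End.mul_apply, Module.End.mul_apply, transfer_apply, transfer_apply]
    calc _ ≤ ∑ a, g (consPast a x) * (Real.exp (L * (c ^ 2 * s ^ 2 / 8))
          * Real.exp (s * (transfer g ^ L) G (consPast a x))) :=
          Finset.sum_le_sum fun a _ => mul_le_mul_of_nonneg_left
            (transfer_pow_exp_le s (fun k hk => hc k (by lia)) _) (hg.pos _).le
      _ = Real.exp (L * (c ^ 2 * s ^ 2 / 8)) * ∑ a, g (consPast a x)
          * Real.exp (s * (transfer g ^ L) G (consPast a x)) := by
          rw [Finset.mul_sum]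
          exact Finset.sum_congr rfl fun a _ => mul_left_comm _ _ _
      _ ≤ Real.exp (L * (c ^ 2 * s ^ 2 / 8)) * (Real.exp (c ^ 2 * s ^ 2 / 8)
          * Real.exp (s * ∑ a, g (consPast a x) * (transfer g ^ L) G (consPast a x))) :=
          mul_le_mul_of_nonneg_left (sum_mul_exp_le (fun a => (hg.pos _).le) (hg.sum_eq_one x)
            (fun a b => hc L L.lt_succ_self a b x) s) (Real.exp_pos _).le
      _ = _ := by
          rw [← mul_assoc, ← Real.exp_add]
          push_cast
          ring_nf

end IsGFunction

lemma setIntegral_eq_integral_mul_of_condExp_ae_eq {Ω : Type*} {m m₀ : MeasurableSpace Ω}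
    {μ : Measure Ω} [IsFiniteMeasure μ] (hm : m ≤ m₀) {s : Set Ω} (hs : MeasurableSet s)
    {p G : Ω → ℝ} {B : ℝ} (hp : μ⟦s | m⟧ =ᵐ[μ] p) (hG : StronglyMeasurable[m] G)
    (hB : ∀ ω, ‖G ω‖ ≤ B) :
    ∫ ω in s, G ω ∂μ = ∫ ω, p ω * G ω ∂μ := by
  have integrable_indicator : Integrable (s.indicator fun _ => (1 : ℝ)) μ :=
    (integrable_const 1).indicator hs
  have integrable_mul : Integrable (G * s.indicator fun _ => (1 : ℝ)) μ :=
    integrable_indicator.bdd_mul (hG.mono hm).aestronglyMeasurable (ae_of_all _ hB)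
  calc ∫ ω in s, G ω ∂μ = ∫ ω, (G * s.indicator fun _ => (1 : ℝ)) ω ∂μ := by
        rw [← integral_indicator hs]
        congr 1 with ω
        by_cases hω : ω ∈ s <;> simp [hω]
    _ = ∫ ω, (μ[G * s.indicator fun _ => (1 : ℝ)|m]) ω ∂μ := (integral_condExp hm).symm
    _ = ∫ ω, p ω * G ω ∂μ := by
        refine integral_congr_ae ?_
        filter_upwards [condExp_mul_of_stronglyMeasurable_left hG integrable_mul
          integrable_indicator, hp] with ω pull_out hω
        rw [pull_out, Pi.mul_apply, hω, mul_comm]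

lemma measureReal_le_abs_le_two_mul_exp {Ω : Type*} [MeasurableSpace Ω] {μ : Measure Ω}
    [IsFiniteMeasure μ] {X : Ω → ℝ} {v : NNReal} (hX : HasSubgaussianMGF X v μ) {r : ℝ}
    (hr : 0 ≤ r) : μ.real {ω | r ≤ |X ω|} ≤ 2 * Real.exp (-r ^ 2 / (2 * v)) :=
  calc μ.real {ω | r ≤ |X ω|} ≤ μ.real ({ω | r ≤ X ω} ∪ {ω | r ≤ (-X) ω}) :=
        measureReal_mono fun _ hω => le_abs.1 (Set.mem_ofPred.1 hω)
    _ ≤ μ.real {ω | r ≤ X ω} + μ.real {ω | r ≤ (-X) ω} := measureReal_union_le _ _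
    _ ≤ 2 * Real.exp (-r ^ 2 / (2 * v)) := by
        linarith [hX.measure_ge_le hr, hX.neg.measure_ge_le hr]

namespace IsCompatible

variable [MeasurableSpace A] [MeasurableSingletonClass A] {φ : Past A → ℝ}
  {μ : Measure (BiSeq A)} (hμ : IsCompatible φ μ)
include hμ

lemma integral_pastOf_add_one (hF : Measurable F) {B : ℝ} (hB : ∀ x, ‖F x‖ ≤ B) {n : ℕ}
    (hn : 1 ≤ n) :
    ∫ ω, F (pastOf (n + 1) ω) ∂μ
      = ∫ ω, transfer (fun x => Real.exp (φ x)) F (pastOf n ω) ∂μ := by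
  have := hμ.isProbabilityMeasure
  let next (a : A) : Set (BiSeq A) := {ω | ω (n + 1) = a}
  have measurable_next (a : A) : MeasurableSet (next a) :=
    measurableSet_eq_fun (measurable_pi_apply _) measurable_const
  have measurable_cons (a : A) : StronglyMeasurable[MeasurableSpace.comap (pastOf (n : ℤ))
      inferInstance] fun ω : BiSeq A => F (consPast a (pastOf n ω)) :=
    ((hF.comp (measurable_consPast a)).comp (comap_measurable _)).stronglyMeasurable
  have integrable_mul (a : A) : Integrable
      (fun ω => Real.exp (φ (consPast a (pastOf n ω))) * F (consPast a (pastOf n ω))) μ :=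
    (integrable_condExp.congr (hμ.cond_prob n hn a)).mul_bdd
      ((measurable_cons a).mono (measurable_pastOf n).comap_le).aestronglyMeasurable
      (ae_of_all _ fun _ => hB _)
  calc ∫ ω, F (pastOf (n + 1) ω) ∂μ = ∫ ω in ⋃ a, next a, F (pastOf (n + 1) ω) ∂μ := by
        rw [Set.iUnion_eq_univ_iff.2 fun ω => ⟨ω (n + 1), rfl⟩, setIntegral_univ]
    _ = ∑ a, ∫ ω in next a, F (pastOf (n + 1) ω) ∂μ :=
        integral_iUnion_fintype measurable_next
          (fun a b hab => Set.disjoint_left.2 fun ω ha hb => hab (ha.symm.trans hb))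
          fun a => (Integrable.of_bound (hF.comp (measurable_pastOf _)).aestronglyMeasurable B
            (ae_of_all _ fun _ => hB _)).integrableOn
    _ = ∑ a, ∫ ω in next a, F (consPast a (pastOf n ω)) ∂μ :=
        Finset.sum_congr rfl fun a _ => setIntegral_congr_fun (measurable_next a)
          fun ω hω => by simp only [pastOf_add_one, show ω (n + 1) = a from hω]
    _ = ∑ a, ∫ ω, Real.exp (φ (consPast a (pastOf n ω))) * F (consPast a (pastOf n ω)) ∂μ :=
        Finset.sum_congr rfl fun a _ => setIntegral_eq_integral_mul_of_condExp_ae_eq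
          (measurable_pastOf n).comap_le (measurable_next a) (hμ.cond_prob n hn a)
          (measurable_cons a) fun _ => hB _
    _ = _ := (integral_finsetSum _ fun a _ => integrable_mul a).symm

variable (hφ : Measurable φ) (hg : IsGFunction fun x => Real.exp (φ x))
include hφ hg

lemma integral_pastOf_eq_integral_transfer_pow :
    ∀ (L : ℕ) {F : Past A → ℝ} {B : ℝ}, Measurable F → (∀ x, ‖F x‖ ≤ B) →
      ∫ ω, F (pastOf (L + 1) ω) ∂μ
        = ∫ ω, (transfer (fun x => Real.exp (φ x)) ^ L) F (pastOf 1 ω) ∂μ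
  | 0, F, _, _, _ => by simp
  | L + 1, F, B, hF, hB => by
    have step := hμ.integral_pastOf_add_one hF hB (Nat.le_add_left 1 L)
    have ih := integral_pastOf_eq_integral_transfer_pow L (measurable_transfer_pow hφ.exp hF 1)
      fun x => abs_le.2 (hg.transfer_pow_mem_Icc (fun y => abs_le.1 (hB y)) 1 x)
    rw [pow_one] at ih
    rw [pow_succ, Module.End.mul_apply, ← ih, Nat.cast_succ]
    exact step

section

variable {G : Past A → ℝ} {B c : ℝ} {L : ℕ} (hG : Measurable G) (hB : ∀ x, ‖G x‖ ≤ B)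
  (hstep : ∀ k < L, ∀ (a b : A) (x : Past A),
    (transfer (fun x => Real.exp (φ x)) ^ k) G (consPast a x)
      - (transfer (fun x => Real.exp (φ x)) ^ k) G (consPast b x) ≤ c)
include hG hB hstep

lemma mgf_pastOf_le (s : ℝ) :
    mgf (fun ω => G (pastOf (L + 1) ω)) μ s ≤ Real.exp (L * (c ^ 2 * s ^ 2 / 8))
      * mgf (fun ω => (transfer (fun x => Real.exp (φ x)) ^ L) G (pastOf 1 ω)) μ s := by
  have := hμ.isProbabilityMeasure
  have exp_le (x : Past A) : ‖Real.exp (s * G x)‖ ≤ Real.exp (|s| * B) := by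
    rw [Real.norm_eq_abs, Real.abs_exp, Real.exp_le_exp]
    exact (le_abs_self _).trans
      ((abs_mul s _).trans_le (mul_le_mul_of_nonneg_left (hB x) (abs_nonneg s)))
  have integrable : Integrable (fun ω =>
      Real.exp (s * (transfer (fun x => Real.exp (φ x)) ^ L) G (pastOf 1 ω))) μ :=
    integrable_exp_mul_of_mem_Icc
      ((measurable_transfer_pow hφ.exp hG L).comp (measurable_pastOf 1)).aemeasurable
      (ae_of_all _ fun ω => hg.transfer_pow_mem_Icc (fun y => abs_le.1 (hB y)) L _)
  rw [mgf, hμ.integral_pastOf_eq_integral_transfer_pow hφ hg L (hG.const_mul s).exp exp_le, mgf,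
    ← integral_const_mul]
  exact integral_mono_of_nonneg
    (ae_of_all _ fun ω => (hg.transfer_pow_mem_Icc
      (fun y => ⟨(Real.exp_pos _).le, (le_abs_self _).trans (exp_le y)⟩) L _).1)
    (integrable.const_mul _) (ae_of_all _ fun ω => hg.transfer_pow_exp_le s hstep _)

lemma hasSubgaussianMGF_pastOf
    (hinit : ∀ x y, (transfer (fun x => Real.exp (φ x)) ^ L) G x
      - (transfer (fun x => Real.exp (φ x)) ^ L) G y ≤ c) :
    HasSubgaussianMGF (fun ω => G (pastOf (L + 1) ω) - ∫ ω', G (pastOf (L + 1) ω') ∂μ)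
      ((L + 1) * (‖c‖₊ / 2) ^ 2) μ := by
  have := hμ.isProbabilityMeasure
  obtain ⟨ω₀⟩ : Nonempty (BiSeq A) := μ.nonempty_of_neZero
  have : Nonempty (Past A) := ⟨pastOf 0 ω₀⟩
  obtain ⟨m, hm⟩ := exists_forall_mem_Icc_of_sub_le hinit
  have hoeffding := hasSubgaussianMGF_of_mem_Icc (μ := μ)
    ((measurable_transfer_pow hφ.exp hG L).comp (measurable_pastOf 1)).aemeasurable
    (ae_of_all _ fun ω => hm (pastOf 1 ω))
  rw [hμ.integral_pastOf_eq_integral_transfer_pow hφ hg L hG hB]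
  refine ⟨fun s => ?_, fun s => ?_⟩
  · exact integrable_exp_mul_of_mem_Icc ((hG.comp (measurable_pastOf _)).sub_const _).aemeasurable
      (ae_of_all _ fun ω => ⟨sub_le_sub_right (abs_le.1 (hB _)).1 _,
        sub_le_sub_right (abs_le.1 (hB _)).2 _⟩)
  · have initial := hoeffding.mgf_le s
    simp only [sub_eq_add_neg, mgf_add_const, Function.comp_apply] at initial ⊢
    refine (mul_le_mul_of_nonneg_right (hμ.mgf_pastOf_le hφ hg hG hB hstep s)
      (Real.exp_pos _).le).trans ?_
    rw [mul_assoc]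
    refine (mul_le_mul_of_nonneg_left initial (Real.exp_pos _).le).trans_eq ?_
    rw [← Real.exp_add]
    congr 1
    simp only [add_neg_cancel_comm, NNReal.coe_mul, NNReal.coe_add, NNReal.coe_natCast,
      NNReal.coe_one, NNReal.coe_pow, NNReal.coe_div, coe_nnnorm, Real.norm_eq_abs,
      NNReal.coe_ofNat, div_pow, sq_abs]
    ring

end

lemma hasSubgaussianMGF_birkhoffSum {f : Past A → ℝ} (hf : Measurable f) {B : ℝ}
    (hB : ∀ x, ‖f x‖ ≤ B) {L : ℕ} {c : ℝ}
    (hc : ∑ j ∈ Finset.range (L + 1),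
      variation ((transfer (fun x => Real.exp (φ x)) ^ j) f) 0 ≤ c) :
    HasSubgaussianMGF
      (fun ω => birkhoffSum shift f (L + 1) (pastOf (L + 1) ω)
        - ∫ ω', birkhoffSum shift f (L + 1) (pastOf (L + 1) ω') ∂μ)
      ((L + 1) * (‖c‖₊ / 2) ^ 2) μ := by
  have conditional {k : ℕ} (hk : k ≤ L) :
      (transfer (fun x => Real.exp (φ x)) ^ k) (birkhoffSum shift f (L + 1))
        = ∑ j ∈ Finset.range (k + 1), (transfer (fun x => Real.exp (φ x)) ^ j) f
          + birkhoffSum shift f (L - k) ∘ shift := by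
    rw [← hg.transfer_pow_birkhoffSum, Nat.add_sub_cancel' hk]
  have oscillation {k : ℕ} (hk : k ≤ L) (x y : Past A) :=
    (hg.sum_transfer_pow_sub_le (fun z => abs_le.1 (hB z)) (Nat.succ_le_succ hk) x y).trans hc
  refine hμ.hasSubgaussianMGF_pastOf hφ hg (B := (L + 1 : ℕ) * B) ?_ (fun x => ?_)
    (fun k hk a b x => ?_) fun x y => ?_
  · exact Finset.measurable_sum _ fun k _ => hf.comp (measurable_shift.iterate k)
  · simpa [birkhoffSum] using norm_sum_le_of_le (Finset.range (L + 1)) fun k _ => hB (shift^[k] x)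
  · simpa only [conditional hk.le, Pi.add_apply, Finset.sum_apply, Function.comp_apply,
      shift_consPast, add_sub_add_right_eq_sub] using
      oscillation hk.le (consPast a x) (consPast b x)
  · simpa only [conditional le_rfl, Nat.sub_self, birkhoffSum_zero', Pi.add_apply,
      Finset.sum_apply, Function.comp_apply, Pi.zero_apply, add_zero] using oscillation le_rfl x y

variable {h : A → ℝ} {n : ℕ} {c : ℝ} (hn : 1 ≤ n)
  (hc : ∑ j ∈ Finset.range n,
    variation ((transfer (fun x => Real.exp (φ x)) ^ j) fun x => h (x 0)) 0 ≤ c)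
include hn hc

lemma hasSubgaussianMGF_sum :
    HasSubgaussianMGF
      (fun ω => ∑ i ∈ Finset.Icc 1 n, (h (ω (i : ℤ)) - ∫ ω', h (ω' (i : ℤ)) ∂μ))
      (n * (‖c‖₊ / 2) ^ 2) μ := by
  have := hμ.isProbabilityMeasure
  obtain ⟨L, rfl⟩ := Nat.exists_eq_add_of_le' hn
  have norm_le (a : A) : ‖h a‖ ≤ ∑ b, ‖h b‖ :=
    Finset.single_le_sum (f := fun b => ‖h b‖) (fun _ _ => norm_nonneg _) (Finset.mem_univ a)
  have measurable_apply (i : ℤ) : Measurable fun ω : BiSeq A => h (ω i) :=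
    (measurable_of_finite h).comp (measurable_pi_apply i)
  have integrable (i : ℕ) : Integrable (fun ω : BiSeq A => h (ω i)) μ :=
    Integrable.of_bound (measurable_apply i).aestronglyMeasurable _ (ae_of_all _ fun _ => norm_le _)
  simp only [Finset.sum_sub_distrib, ← integral_finsetSum _ fun i _ => integrable i,
    ← birkhoffSum_shift_pastOf]
  exact_mod_cast hμ.hasSubgaussianMGF_birkhoffSum hφ hg
    ((measurable_of_finite h).comp (measurable_pi_apply 0)) (fun x => norm_le (x 0)) hc

lemma measureReal_le_abs_average_le {t : ℝ} (ht : 0 ≤ t) :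
    μ.real {ω | t ≤ |(1 / (n : ℝ))
        * ∑ i ∈ Finset.Icc 1 n, (h (ω (i : ℤ)) - ∫ ω', h (ω' (i : ℤ)) ∂μ)|}
      ≤ 2 * Real.exp (-(2 * n * t ^ 2 / c ^ 2)) := by
  have := hμ.isProbabilityMeasure
  have hn0 : (0 : ℝ) < n := by exact_mod_cast hn
  have tail := measureReal_le_abs_le_two_mul_exp (hμ.hasSubgaussianMGF_sum hφ hg hn hc)
    (mul_nonneg hn0.le ht)
  have average (S : ℝ) : t ≤ |1 / (n : ℝ) * S| ↔ n * t ≤ |S| := by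
    rw [abs_mul, abs_of_pos (one_div_pos.2 hn0), one_div, ← div_eq_inv_mul, le_div_iff₀' hn0]
  simp only [average]
  refine tail.trans_eq ?_
  congr 2
  simp only [NNReal.coe_mul, NNReal.coe_natCast, NNReal.coe_pow, NNReal.coe_div, coe_nnnorm,
    Real.norm_eq_abs, NNReal.coe_ofNat, div_pow, sq_abs]
  field_simp

end IsCompatible

end Concentration

section Potentials

variable {A : Type*} {φ : Past A → ℝ}

lemma IsPotential.isGFunction [MeasurableSpace A] [Fintype A] (hφ : IsPotential φ) :
    IsGFunction fun x => Real.exp (φ x) where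
  pos _ := Real.exp_pos _
  sum_eq_one x := (hasSum_fintype _).unique (hφ.normalized x)

lemma IsPotential.finite [MeasurableSpace A] [Nonempty A] (hφ : IsPotential φ) {ε : ℝ}
    (hε : 0 < ε) (hφε : ∀ x, ε ≤ Real.exp (φ x)) : Finite A := by
  by_contra hA
  rw [not_finite_iff_infinite] at hA
  have x : Past A := fun _ => Classical.arbitrary A
  have summable_const : Summable fun _ : A => ε :=
    .of_nonneg_of_le (fun _ => hε.le) (fun a => hφε (consPast a x)) (hφ.normalized x).summable
  exact hε.ne' ((summable_const_iff ε).1 summable_const)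

lemma chiSqDiv_le_of_chiSqRate_le [Fintype A] {k : ℕ} {u : ℝ} (hu : 0 ≤ u)
    (h : chiSqRate φ k ≤ ENNReal.ofReal u) {x y : Past A} (hxy : x ∈ PiNat.cylinder y k) :
    chiSqDiv (fun a => Real.exp (φ (consPast a x))) (fun a => Real.exp (φ (consPast a y))) ≤ u := by
  obtain ⟨z, x', y', rfl, rfl⟩ := exists_concatPast_eq hxy
  have le_rate := (le_iSup₂_of_le z x' (le_iSup_of_le y' le_rfl)).trans h
  rwa [tsum_fintype, ← ENNReal.ofReal_sum_of_nonneg fun b _ => by positivity,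
    ENNReal.ofReal_le_ofReal_iff hu] at le_rate

lemma apply_mem_Icc_iInf_iSup [Finite A] (h : A → ℝ) (a : A) :
    h a ∈ Set.Icc (⨅ a, h a) (⨆ a, h a) :=
  ⟨ciInf_le (Set.finite_range h).bddBelow a, le_ciSup (Set.finite_range h).bddAbove a⟩

lemma rpow_mul_sq_div_sq_le {K R ρ δ' t : ℝ} {n : ℕ} (hn : 1 ≤ n) (hρ : (1 + δ') / 2 ≤ ρ) :
    2 / K ^ 2 * (n : ℝ) ^ δ' * t ^ 2 / R ^ 2
      ≤ 2 * n * t ^ 2 / (K * (n : ℝ) ^ (1 - ρ) * R) ^ 2 := by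
  have hn1 : (1 : ℝ) ≤ n := by exact_mod_cast hn
  have hn0 : (0 : ℝ) < n := by linarith
  have rpow_le : (n : ℝ) ^ δ' ≤ n / ((n : ℝ) ^ (1 - ρ)) ^ 2 := by
    rw [le_div_iff₀ (by positivity), ← Real.rpow_mul_natCast hn0.le, ← Real.rpow_add hn0]
    exact (Real.rpow_le_rpow_of_exponent_le hn1 (by push_cast; linarith)).trans_eq
      (Real.rpow_one _)
  calc _ ≤ 2 / K ^ 2 * (n / ((n : ℝ) ^ (1 - ρ)) ^ 2) * t ^ 2 / R ^ 2 := by gcongr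
    _ = _ := by
        simp only [div_eq_mul_inv, mul_pow, mul_inv]
        ring

end Potentials

end

theorem mainTheorem6_general (C δ δ' ε : ℝ) (hC : 0 < C) (hδ : 0 < δ) (hδ' : δ' < 2 * δ - 1)
    (hδ'1 : δ' ≤ 1) (hε : 0 < ε) :
    ∃ C₇ : ℝ, 0 < C₇ ∧
      ∀ (A : Type*) [MeasurableSpace A] [MeasurableSingletonClass A] (φ : Past A → ℝ),
        (∀ x : Past A, ε ≤ Real.exp (φ x)) → AssumptionA φ C δ →
        ∀ μ : Measure (BiSeq A), IsCompatible φ μ →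
        ∀ (n : ℕ), 1 ≤ n → ∀ (t : ℝ), 0 ≤ t → ∀ (h : A → ℝ),
          μ.real {ω : BiSeq A |
              t ≤ |(1 / (n : ℝ)) *
                ∑ i ∈ Finset.Icc 1 n, (h (ω (i : ℤ)) - ∫ ω', h (ω' (i : ℤ)) ∂μ)|}
            ≤ 2 * Real.exp (-(C₇ * (n : ℝ) ^ δ' * t ^ 2 / oscRange h ^ 2)) := by
  set ρ : ℝ := max 0 ((1 + δ') / 2)
  obtain ⟨k₀, htail, hk₀⟩ := (((tendsto_failureTail C ρ δ).eventually_le_const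
    (half_pos one_pos)).and (eventually_ge_atTop 1)).exists
  refine ⟨2 / (2 * k₀ / ε ^ k₀ + 2) ^ 2, by positivity, ?_⟩
  intro A _ _ φ hφε hA μ hμ n hn t ht h
  have := hμ.isProbabilityMeasure
  obtain ⟨ω⟩ : Nonempty (BiSeq A) := μ.nonempty_of_neZero
  have : Nonempty A := ⟨ω 0⟩
  have := hA.potential.finite hε hφε
  have := Fintype.ofFinite A
  have hg := hA.potential.isGFunction
  have sum_variation_le := hg.sum_variation_transfer_pow_zero_le
    (fun k hk x y => chiSqDiv_le_of_chiSqRate_le (by positivity) (hA.bound k hk)) hC.le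
    (le_max_left _ _) (max_le zero_le_one (by linarith)) (max_lt hδ (by linarith)) hε hφε hk₀ htail
    (fun x => apply_mem_Icc_iInf_iSup h (x 0)) (fun _ => variation_comp_head h) hn
  refine (hμ.measureReal_le_abs_average_le hA.potential.measurable hg hn sum_variation_le ht).trans
    (mul_le_mul_of_nonneg_left (Real.exp_le_exp.2 (neg_le_neg ?_)) zero_le_two)
  exact rpow_mul_sq_div_sq_le hn (le_max_right _ _)

theorem mainTheorem6 (C δ δ' ε : ℝ) (hC : 0 < C) (hδ : 1 / 2 < δ) (hδ1 : δ ≤ 1)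
    (hδ' : δ' < 2 * δ - 1) (hε : 0 < ε) :
    ∃ C₇ : ℝ, 0 < C₇ ∧
      ∀ (A : Type*) [Countable A] [MeasurableSpace A] [MeasurableSingletonClass A]
        (φ : Past A → ℝ), IsRegularPotential φ → (∀ x : Past A, ε ≤ Real.exp (φ x)) →
        AssumptionA φ C δ →
        ∀ μ : Measure (BiSeq A), IsCompatible φ μ →
        ∀ (n : ℕ), 1 ≤ n → ∀ (t : ℝ), 0 ≤ t → ∀ (h : A → ℝ),
          μ.real {ω : BiSeq A |
              t ≤ |(1 / (n : ℝ)) *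
                ∑ i ∈ Finset.Icc 1 n, (h (ω (i : ℤ)) - ∫ ω', h (ω' (i : ℤ)) ∂μ)|}
            ≤ 2 * Real.exp (-(C₇ * (n : ℝ) ^ δ' * t ^ 2 / oscRange h ^ 2)) := by
  obtain ⟨C₇, hC₇, h⟩ := mainTheorem6_general C δ δ' ε hC (by linarith) hδ' (by linarith) hε
  exact ⟨C₇, hC₇, fun A _ _ _ φ _ => h A φ⟩
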